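/- Logarithms are to base $2$. For $k\ge 2$ and a Boolean function $f$ of $k$ inputs, let $D_k(f)$ be its deterministic number-on-the-forehead communication complexity: the least $t$ such that some protocol, in which the $k$ players write single bits on a blackboard, each bit depending only on the previous bits and on the inputs other than the writer's own, and in which the final transcript determines the output, computes $f$ and writes at most $t$ bits on every input. For $A : X^{k-1}\to Y$ let $\mathrm{Lift}(A) : X^{k-1}\times Y\to\{0,1\}$ be the graph function with $\mathrm{Lift}(A)(x_1,\dots,x_{k-1},y)=1$ if and only if $A(x_1,\dots,x_{k-1})=y$. For a prime power $N$ let $T_{N,d,m} : (\mathbb F_N^{d\times d})^m\to\mathbb F_N$, $T_{N,d,m}(B_1,\dots,B_m)=\mathrm{Tr}(B_1B_2\cdots B_m)$. There is an absolute constant $c_0>0$ such that for every real $c\ge c_0$ and every real $a$ there is a $\delta>0$ (depending only on $c$ and $a$) for which the following holds. Let $N$ be a prime power, let $k\ge 2$ be an integer, let $$d=\Big\lceil c\,k^{3/2}\,2^{k/2}\sqrt{N/\log N}\,\Big\rceil ,$$ let $A=T_{N,d,k-1}$ and $f=\mathrm{Lift}(A)$, and let $n=|\mathbb F_N^{d\times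 d}|=N^{d^2}$, so that $f$ is an explicit graph function with domain $[n]^{k-1}\times[N]$ (up to naming the inputs). Then 1. $D_k(f)\ge\log N$; 2. $\log N\ge \log\log n-k-3\log k-2\log(c+1)$; 3. if $k\le N^{a}$, then $\log N\ge\delta\,(\log\log n-k)$; 4. if $k\le a\log N$, then $\log N\ge\delta\,\log\log n$. That is, $D_k(f)\ge\log N\ge\Omega(\log\log n-k)$ as long as $k$ is at most polynomial in $N$, and $D_k(f)\ge\Omega(\log\log n)$ as long as $k=O(\log N)$, in particular for every fixed $k$. -/

import Mathlib

universe u v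

/-- A deterministic number-on-the-forehead protocol for players indexed by `ι`, where player `i`
has an input in `X i` on the forehead. At an inner node of the tree (which is determined by what
is written on the blackboard so far) some player `i` writes one bit, which may depend on all the
inputs except the one of player `i`. At a leaf the transcript determines the Boolean output. -/
inductive NOFProtocol {ι : Type v} (X : ι → Type u) : Type (max u v) where
  | output (z : Bool) : NOFProtocol X
  | speak (i : ι) (bit : ((j : {j : ι // j ≠ i}) → X j) → Bool)
      (next : Bool → NOFProtocol X) : NOFProtocol X

namespace NOFProtocol

variable {ι : Type v} {X : ι → Type u}

/-- What player `i` sees on the input `x`: all the inputs except the one of player `i`. -/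
def view (x : (j : ι) → X j) (i : ι) : (j : {j : ι // j ≠ i}) → X j := fun j => x j

/-- The output of the protocol on the input `x`. -/
def eval : NOFProtocol X → ((j : ι) → X j) → Bool
  | output z, _ => z
  | speak i bit next, x => eval (next (bit (view x i))) x

/-- The number of bits written on the blackboard on the input `x`. -/
def bits : NOFProtocol X → ((j : ι) → X j) → ℕ
  | output _, _ => 0
  | speak i bit next, x => bits (next (bit (view x i))) x + 1

end NOFProtocol

/-- The deterministic number-on-the-forehead communication complexity of `f`: the least `t` such
that some protocol computes `f` and writes at most `t` bits on every input. -/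
noncomputable def detNOF {ι : Type v} {X : ι → Type u} (f : ((j : ι) → X j) → Bool) : ℕ :=
  sInf {t : ℕ | ∃ P : NOFProtocol X, ∀ x, P.eval x = f x ∧ P.bits x ≤ t}

namespace NOFProtocol

variable {ι : Type v} {X : ι → Type u}

/-- The protocol that asks a fixed list of questions, each to one player, and then outputs a
function of the answers. -/
def ask : List ((i : ι) × (((j : {j : ι // j ≠ i}) → X j) → Bool)) → (List Bool → Bool) →
    NOFProtocol X
  | [], g => output (g [])
  | q :: qs, g => speak q.1 q.2 (fun b => ask qs (fun l => g (b :: l)))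

theorem eval_ask (qs : List ((i : ι) × (((j : {j : ι // j ≠ i}) → X j) → Bool)))
    (g : List Bool → Bool) (x : (j : ι) → X j) :
    (ask qs g).eval x = g (qs.map fun q => q.2 (view x q.1)) ∧
      (ask qs g).bits x ≤ qs.length := by
  induction qs generalizing g with
  | nil => simp [ask, eval, bits]
  | cons q qs ih =>
    have h := ih (fun l => g (q.2 (view x q.1) :: l))
    simp only [ask, eval, bits, List.map_cons, List.length_cons]
    exact ⟨h.1, Nat.succ_le_succ h.2⟩

end NOFProtocol

/-- With at least two players and finite input spaces every function has a protocol, so that the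
infimum in `detNOF` is attained. -/
theorem exists_protocol_detNOF {ι : Type v} {X : ι → Type u} [Finite ι] [Nontrivial ι]
    [∀ j, Finite (X j)] (f : ((j : ι) → X j) → Bool) :
    ∃ P : NOFProtocol X, ∀ x, P.eval x = f x ∧ P.bits x ≤ detNOF f := by
  classical
  suffices h : {t : ℕ | ∃ P : NOFProtocol X, ∀ x, P.eval x = f x ∧ P.bits x ≤ t}.Nonempty from
    Nat.sInf_mem h
  cases nonempty_fintype ι
  have : ∀ j, Fintype (X j) := fun j => Fintype.ofFinite _
  choose w hw using fun j : ι => exists_ne j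
  let Q : ((j : ι) × X j) → ((i : ι) × (((j : {j : ι // j ≠ i}) → X j) → Bool)) :=
    fun p => ⟨w p.1, fun y => decide (y ⟨p.1, (hw p.1).symm⟩ = p.2)⟩
  let qs := (Finset.univ : Finset ((j : ι) × X j)).toList.map Q
  let ans : ((j : ι) → X j) → List Bool := fun x => qs.map fun q => q.2 (NOFProtocol.view x q.1)
  have hinj : Function.Injective ans := by
    intro x y hxy
    funext j
    simp only [ans, qs, List.map_map] at hxy
    have h := List.map_inj_left.1 hxy ⟨j, x j⟩ (Finset.mem_toList.2 (Finset.mem_univ _))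
    change decide (x j = x j) = decide (y j = x j) at h
    exact ((decide_eq_decide.1 h).1 rfl).symm
  let g : List Bool → Bool := fun l => decide (∃ x, ans x = l ∧ f x = true)
  refine ⟨qs.length, NOFProtocol.ask qs g, fun x => ?_⟩
  obtain ⟨h1, h2⟩ := NOFProtocol.eval_ask qs g x
  refine ⟨h1.trans ?_, h2⟩
  change decide (∃ z, ans z = ans x ∧ f z = true) = f x
  have key : (∃ z, ans z = ans x ∧ f z = true) ↔ f x = true :=
    ⟨fun ⟨z, hz, hf⟩ => hinj hz ▸ hf, fun h => ⟨x, rfl, h⟩⟩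
  rw [Bool.eq_iff_iff, decide_eq_true_iff]
  exact key

/-- The input spaces for a graph function: the first `m` players `some 0, …, some (m - 1)` have
inputs in `X`, and the last player `none` has an input in `Y`. There are `m + 1` players. -/
def GraphInput (m : ℕ) (X Y : Type u) : Option (Fin m) → Type u
  | some _ => X
  | none => Y

open Classical in
/-- The graph function `Lift A` of `A : X ^ m → Y`, which is `1` on `(x₁, …, xₘ, y)` if and only
if `A (x₁, …, xₘ) = y`. -/
noncomputable def Lift {m : ℕ} {X Y : Type u} (A : (Fin m → X) → Y) :
    ((j : Option (Fin m)) → GraphInput m X Y j) → Bool :=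
  fun z => decide (A (fun i => z (some i)) = z none)

/-- The trace of the product `B₁ B₂ ⋯ Bₘ` of `m` matrices of size `d × d` over `F`. -/
def traceProd (F : Type u) [Field F] (d m : ℕ) : (Fin m → Matrix (Fin d) (Fin d) F) → F :=
  fun B => Matrix.trace (List.ofFn B).prod

/-! A protocol that writes at most `t` bits splits the inputs into at most `2 ^ t` cylinder
intersections with constant output. The graph of `A` has one point for each tuple `x`, so it is
enough that a cylinder intersection inside the graph holds hardly more than a `1 / N` fraction of
these points (`card_ones_le`, `card_le_two_pow_detNOF_lift`).

Below each `x` in the projection of such a set, the constraints of the players `some i` allow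
exactly one value, namely `A x`. By inclusion-exclusion, the set of `x` with `v` as only allowed
value is a signed sum of fewer than `2 ^ N` cylinder intersections in `x` alone. If the nontrivial
characters of `A` correlate with these far less than `2 ^ (-N)`, then `A` is nearly equidistributed
on that set and equals `v` on about a `1 / N` fraction of it. The sets for different `v` are
disjoint (`card_exact_le`).

For the trace with `k = m + 2` players, `m` Cauchy-Schwarz steps bound the `2 ^ m`-th power of the
normalised correlation by the probability that `m` random matrices have product zero
(`norm_sum_mul_prod_pow_le`). By Sylvester's inequality one of them then has corank at least `d /
m`, which for one matrix has probability at most `2 ^ d * N ^ (-(d / m) ^ 2)`. The given `d` makes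
this beat `2 ^ (-4 * N * 2 ^ m)`, while `log n = d ^ 2 * log N` stays small enough for the bounds on
`log log n`. -/

/-! ### Ranks and the number of matrices of large corank -/

/-- Sylvester's rank inequality for square matrices. -/
theorem rank_add_rank_le_rank_mul_add {F : Type*} [Field F] {d : ℕ}
    (A B : Matrix (Fin d) (Fin d) F) : A.rank + B.rank ≤ (A * B).rank + d := by
  have hA := A.mulVecLin.finrank_range_add_finrank_ker
  have hB := B.mulVecLin.finrank_range_add_finrank_ker
  have hAB := (A * B).mulVecLin.finrank_range_add_finrank_ker
  rw [Module.finrank_fin_fun] at hA hB hAB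
  have hker : Module.finrank F (LinearMap.ker (A * B).mulVecLin) ≤
      Module.finrank F (LinearMap.ker B.mulVecLin) +
        Module.finrank F (LinearMap.ker A.mulVecLin) := by
    rw [Matrix.mulVecLin_mul]
    -- Restricted to the kernel of `A * B`, the map `B` has its image in the kernel of `A` and its
    -- kernel inside that of `B`.
    set g := B.mulVecLin.domRestrict (LinearMap.ker (A.mulVecLin ∘ₗ B.mulVecLin)) with hg
    have h := g.finrank_range_add_finrank_ker
    have h1 : Module.finrank F (LinearMap.range g) ≤
        Module.finrank F (LinearMap.ker A.mulVecLin) := by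
      apply Submodule.finrank_mono
      rintro _ ⟨v, rfl⟩
      exact v.2
    have h2 : Module.finrank F (LinearMap.ker g) ≤
        Module.finrank F (LinearMap.ker B.mulVecLin) := by
      refine LinearMap.finrank_le_finrank_of_injective
        (f := ((Submodule.subtype _).comp (Submodule.subtype _)).codRestrict
          (LinearMap.ker B.mulVecLin) fun v => ?_) ?_
      · exact v.2
      · intro v w hvw
        have := congrArg Subtype.val hvw
        exact Subtype.ext (Subtype.ext this)
    omega
  change Module.finrank F (LinearMap.range A.mulVecLin) +
    Module.finrank F (LinearMap.range B.mulVecLin) ≤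
      Module.finrank F (LinearMap.range (A * B).mulVecLin) + d
  omega

/-- The rows of a matrix are spanned by as many of them as the rank says. -/
theorem exists_row_basis {F : Type*} [Field F] {d : ℕ} (A : Matrix (Fin d) (Fin d) F) :
    ∃ I : Finset (Fin d), I.card = A.rank ∧
      ∀ i, ∃ w : I → F, A.row i = ∑ j, w j • A.row j := by
  classical
  obtain ⟨b, -, -, hspan, hli⟩ := exists_linearIndepOn_extension (K := F) (v := A.row)
    (linearIndepOn_empty F A.row) (Set.subset_univ _)
  refine ⟨b.toFinset, ?_, fun i => ?_⟩
  · rw [A.rank_eq_finrank_span_row]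
    have hs : Submodule.span F (Set.range A.row) = Submodule.span F (A.row '' b) := by
      apply le_antisymm
      · rw [Submodule.span_le, ← Set.image_univ]; exact hspan
      · exact Submodule.span_mono (Set.image_subset_range _ _)
    rw [hs, Set.image_eq_range, finrank_span_eq_card hli, Set.toFinset_card]
  · have h : A.row i ∈ Submodule.span F (A.row '' (b.toFinset : Set (Fin d))) := by
      rw [Set.coe_toFinset]
      exact hspan ⟨i, trivial, rfl⟩
    obtain ⟨w, hw⟩ := (Submodule.mem_span_image_finset_iff_exists_fun F).1 h
    exact ⟨w, hw.symm⟩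

open Classical in
/-- There are few matrices of corank at least `s`. -/
theorem card_corank_le {F : Type*} [Field F] [Fintype F] (d s : ℕ) :
    (Finset.univ.filter fun C : Matrix (Fin d) (Fin d) F => C.rank + s ≤ d).card *
        Fintype.card F ^ (s ^ 2) ≤ 2 ^ d * Fintype.card F ^ (d ^ 2) := by
  have hF : 0 < Fintype.card F := Fintype.card_pos
  let J : Finset (Finset (Fin d)) := Finset.univ.filter fun I => I.card + s ≤ d
  -- A matrix is encoded by a row basis `I`, the rows in `I`, and the coefficients that express the
  -- other rows through them.
  let φ : (I : Finset (Fin d)) → ((I → Fin d → F) × ({i // i ∉ I} → I → F)) →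
      Matrix (Fin d) (Fin d) F := fun I p i =>
    if h : i ∈ I then p.1 ⟨i, h⟩ else ∑ j, p.2 ⟨i, h⟩ j • p.1 j
  have hsub : (Finset.univ.filter fun C : Matrix (Fin d) (Fin d) F => C.rank + s ≤ d) ⊆
      J.biUnion fun I => Finset.univ.image (φ I) := by
    intro C hC
    rw [Finset.mem_filter] at hC
    obtain ⟨I, hI, hw⟩ := exists_row_basis C
    choose w hw using hw
    simp only [Finset.mem_biUnion, Finset.mem_image, J, Finset.mem_filter, Finset.mem_univ,
      true_and]
    refine ⟨I, hI ▸ hC.2, (fun j => C j, fun i => w i), ?_⟩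
    funext i
    by_cases h : i ∈ I
    · simp [φ, h]
    · simp only [φ, h, dite_false]
      exact (hw i).symm
  have hcard : ∀ I ∈ J, (Finset.univ.image (φ I)).card * Fintype.card F ^ (s ^ 2) ≤
      Fintype.card F ^ (d ^ 2) := by
    intro I hI
    have hI' : I.card + s ≤ d := (Finset.mem_filter.1 hI).2
    obtain ⟨e, he⟩ := Nat.exists_eq_add_of_le hI'
    calc (Finset.univ.image (φ I)).card * Fintype.card F ^ (s ^ 2)
        ≤ Fintype.card F ^ (d * I.card + I.card * (d - I.card)) * Fintype.card F ^ (s ^ 2) := by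
          gcongr
          refine Finset.card_image_le.trans (le_of_eq ?_)
          rw [Finset.card_univ, Fintype.card_prod]
          simp only [Fintype.card_fun, Fintype.card_coe, Fintype.card_fin]
          rw [Fintype.card_subtype_compl]
          simp [← pow_mul, pow_add]
      _ ≤ _ := by
          -- With `r = I.card`, the exponent `d * r + r * (d - r)` is `d ^ 2 - (d - r) ^ 2`, and `d
          -- - r ≥ s`.
          rw [← pow_add]
          apply Nat.pow_le_pow_right hF
          have : d - I.card = s + e := by omega
          rw [this]
          nlinarith
  calc _ ≤ (∑ I ∈ J, (Finset.univ.image (φ I)).card) * Fintype.card F ^ (s ^ 2) := by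
        gcongr
        exact (Finset.card_le_card hsub).trans Finset.card_biUnion_le
    _ ≤ ∑ I ∈ J, Fintype.card F ^ (d ^ 2) := by
        rw [Finset.sum_mul]
        exact Finset.sum_le_sum hcard
    _ ≤ _ := by
        rw [Finset.sum_const, smul_eq_mul]
        gcongr
        refine (Finset.card_le_univ J).trans ?_
        simp

/-! ### Vanishing products of matrices -/

open Classical in
/-- The number of `C₁, …, Cₘ` with `M * C₁ * ⋯ * Cₘ = 0`. -/
noncomputable def zeroCount {F : Type*} [Field F] [Fintype F] {d : ℕ} :
    ℕ → Matrix (Fin d) (Fin d) F → ℕ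
  | 0, M => if M = 0 then 1 else 0
  | m + 1, M => ∑ C, zeroCount m (M * C)

open Classical in
theorem zeroCount_le_pow {F : Type*} [Field F] [Fintype F] {d : ℕ} (m : ℕ)
    (M : Matrix (Fin d) (Fin d) F) :
    zeroCount m M ≤ Fintype.card (Matrix (Fin d) (Fin d) F) ^ m := by
  induction m generalizing M with
  | zero => simp only [zeroCount]; split_ifs <;> simp
  | succ m ih =>
    refine (Finset.sum_le_sum fun C _ => ih (M * C)).trans ?_
    simp [pow_succ']

open Classical in
/-- If a product of `m + 1` matrices vanishes, then one of them has a large corank. -/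
theorem zeroCount_mul_card_le {F : Type*} [Field F] [Fintype F] {d s : ℕ} (m : ℕ)
    (M : Matrix (Fin d) (Fin d) F) (hM : m * s < M.rank) :
    zeroCount m M * Fintype.card (Matrix (Fin d) (Fin d) F) ≤
      m * (Finset.univ.filter fun C : Matrix (Fin d) (Fin d) F => C.rank + (s + 1) ≤ d).card *
        Fintype.card (Matrix (Fin d) (Fin d) F) ^ m := by
  set q := Fintype.card (Matrix (Fin d) (Fin d) F) with hq
  set Z := Finset.univ.filter fun C : Matrix (Fin d) (Fin d) F => C.rank + (s + 1) ≤ d with hZ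
  induction m generalizing M with
  | zero =>
    have : M ≠ 0 := by
      rintro rfl
      simp at hM
    simp [zeroCount, this]
  | succ m ih =>
    -- For `C ∈ Z` the trivial bound suffices. Otherwise `C` has corank at most `s`, so multiplying
    -- by it costs `M` at most `s` in rank and the induction hypothesis applies to `M * C`.
    have hb : ∀ C, zeroCount m (M * C) * q ≤ m * Z.card * q ^ m + if C ∈ Z then q ^ (m + 1) else 0 := by
      intro C
      split_ifs with hC
      · refine le_add_left ?_
        rw [pow_succ]
        exact Nat.mul_le_mul_right _ (zeroCount_le_pow m _)
      · refine le_add_right (ih (M * C) ?_)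
        have h1 := rank_add_rank_le_rank_mul_add M C
        have h2 : ¬ (C.rank + (s + 1) ≤ d) := by simpa [hZ] using hC
        rw [Nat.succ_mul] at hM
        omega
    calc zeroCount (m + 1) M * q = ∑ C, zeroCount m (M * C) * q := by
          rw [zeroCount, Finset.sum_mul]
      _ ≤ ∑ C, (m * Z.card * q ^ m + if C ∈ Z then q ^ (m + 1) else 0) :=
          Finset.sum_le_sum fun C _ => hb C
      _ = (m + 1) * Z.card * q ^ (m + 1) := by
          rw [Finset.sum_add_distrib, Finset.sum_ite_mem, Finset.univ_inter]
          simp only [Finset.sum_const, Finset.card_univ, ← hq, smul_eq_mul]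
          ring

/-! ### Character sums and the Babai-Nisan-Szegedy bound -/

/-- Sums of an additive character along the linear forms `B ↦ Tr (M B)`. -/
theorem norm_sum_trace_le {F : Type*} [Field F] [Fintype F] {d : ℕ} {ψ : AddChar F ℂ}
    (hψ : ψ ≠ 0) (M : Matrix (Fin d) (Fin d) F) :
    ‖∑ B, ψ (Matrix.trace (M * B))‖ ≤
      Fintype.card (Matrix (Fin d) (Fin d) F) * (zeroCount 0 M : ℝ) := by
  classical
  let φ : AddChar (Matrix (Fin d) (Fin d) F) ℂ :=
    ψ.compAddMonoidHom
      ((Matrix.traceAddMonoidHom (Fin d) F).comp (AddMonoidHom.mulLeft M))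
  have hφ : ∀ B, φ B = ψ (Matrix.trace (M * B)) := fun B => rfl
  simp_rw [← hφ]
  rw [AddChar.sum_eq_ite]
  split_ifs with h0
  · have hM : M = 0 := by
      ext i j
      by_contra hij
      apply hψ
      ext t
      -- If `M i j ≠ 0`, this test matrix makes the trace equal to the arbitrary element `t`, so a
      -- trivial `φ` would force `ψ` to be trivial.
      have h1 := congrArg (fun χ : AddChar _ ℂ => χ (Matrix.single j i ((M i j)⁻¹ * t))) h0
      simp only [hφ, AddChar.zero_apply] at h1
      rw [Matrix.trace_mul_comm, Matrix.trace_single_mul] at h1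
      rw [AddChar.zero_apply, ← h1]
      congr 1
      change _ = ((M i j)⁻¹ * t) * M i j
      field_simp [show M i j ≠ 0 from hij]
    simp [zeroCount, hM]
  · simp only [norm_zero]
    positivity

open Classical in
/-- The bound of Babai, Nisan and Szegedy for the correlation of a character of the trace of a
product with a product of functions each of which ignores one of the matrices. -/
theorem norm_sum_mul_prod_pow_le {F : Type*} [Field F] [Fintype F] {d : ℕ} {ψ : AddChar F ℂ}
    (hψ : ψ ≠ 0) (m : ℕ) (M : Matrix (Fin d) (Fin d) F)
    (g : Fin (m + 1) → (Fin (m + 1) → Matrix (Fin d) (Fin d) F) → ℂ)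
    (hg1 : ∀ i x, ‖g i x‖ ≤ 1)
    (hg : ∀ i x y, (∀ j, j ≠ i → x j = y j) → g i x = g i y) :
    ‖∑ x, ψ (Matrix.trace (M * (List.ofFn x).prod)) * ∏ i, g i x‖ ^ 2 ^ m *
        (Fintype.card (Matrix (Fin d) (Fin d) F) : ℝ) ^ m ≤
      (Fintype.card (Matrix (Fin d) (Fin d) F) : ℝ) ^ ((m + 1) * 2 ^ m) * zeroCount m M := by
  set q : ℝ := (Fintype.card (Matrix (Fin d) (Fin d) F) : ℝ) with hq
  have hq0 : 0 < q := by
    rw [hq]; exact_mod_cast Fintype.card_pos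
  induction m generalizing M with
  | zero =>
    have h1 : ∀ x : Fin 1 → Matrix (Fin d) (Fin d) F, ψ (Matrix.trace (M * (List.ofFn x).prod)) * ∏ i, g i x =
        ψ (Matrix.trace (M * x 0)) * g 0 0 := by
      intro x
      rw [Fin.prod_univ_one, hg 0 x 0 (fun j hj => absurd (Fin.fin_one_eq_zero j) hj)]
      simp
    have h3 : ∑ x : Fin 1 → Matrix (Fin d) (Fin d) F, ψ (Matrix.trace (M * x 0)) =
        ∑ B, ψ (Matrix.trace (M * B)) :=
      (Equiv.funUnique (Fin 1) (Matrix (Fin d) (Fin d) F)).sum_comp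
        fun B => ψ (Matrix.trace (M * B))
    rw [Finset.sum_congr rfl fun x _ => h1 x, ← Finset.sum_mul, h3]
    have h2 := norm_sum_trace_le hψ M
    simp only [pow_zero, pow_one, mul_one, zero_add, norm_mul]
    calc _ ≤ ‖∑ B, ψ (Matrix.trace (M * B))‖ * 1 := by gcongr; exact hg1 _ _
      _ ≤ _ := by rw [mul_one]; exact h2
  | succ m ih =>
    let h : (Fin (m + 1) → Matrix (Fin d) (Fin d) F) → Matrix (Fin d) (Fin d) F → ℂ := fun y a =>
      ψ (Matrix.trace (M * (a * (List.ofFn y).prod))) *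
        ∏ i : Fin (m + 1), g i.succ (Fin.cons a y : Fin (m + 2) → Matrix (Fin d) (Fin d) F)
    let G : Matrix (Fin d) (Fin d) F × Matrix (Fin d) (Fin d) F → Fin (m + 1) → (Fin (m + 1) → Matrix (Fin d) (Fin d) F) → ℂ := fun p i y =>
      g i.succ (Fin.cons p.1 y : Fin (m + 2) → Matrix (Fin d) (Fin d) F) *
        (starRingEnd ℂ) (g i.succ (Fin.cons p.2 y : Fin (m + 2) → Matrix (Fin d) (Fin d) F))
    let s : Matrix (Fin d) (Fin d) F × Matrix (Fin d) (Fin d) F → ℝ := fun p =>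
      ‖∑ y, ψ (Matrix.trace (M * (p.1 - p.2) * (List.ofFn y).prod)) * ∏ i, G p i y‖
    -- The factor `g 0` ignores the first matrix, so it leaves the inner sum; the `0` in `Fin.cons 0
    -- y` is a dummy.
    have hsplit : ∑ x, ψ (Matrix.trace (M * (List.ofFn x).prod)) * ∏ i, g i x =
        ∑ y, g 0 (Fin.cons 0 y : Fin (m + 2) → Matrix (Fin d) (Fin d) F) * ∑ a, h y a := by
      rw [← (Fin.consEquiv fun _ : Fin (m + 2) => Matrix (Fin d) (Fin d) F).sum_comp, Fintype.sum_prod_type_right]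
      refine Finset.sum_congr rfl fun y _ => ?_
      rw [Finset.mul_sum]
      refine Finset.sum_congr rfl fun a _ => ?_
      have h0 : g 0 (Fin.cons 0 y : Fin (m + 2) → Matrix (Fin d) (Fin d) F) = g 0 (Fin.cons a y : Fin (m + 2) → Matrix (Fin d) (Fin d) F) := by
        apply hg
        intro j hj
        obtain ⟨j', rfl⟩ := Fin.exists_succ_eq.2 hj
        simp
      simp only [Fin.consEquiv, Equiv.coe_fn_mk]
      rw [Fin.prod_univ_succ, h0]
      simp only [h, List.ofFn_succ, Fin.cons_zero, Fin.cons_succ, List.prod_cons]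
      ring
    -- The trace is linear in the first matrix, so the pair `(a, b)` from the square gives a sum of
    -- the same kind with prefix `M * (a - b)`. This is why the induction carries a general `M`.
    have hsq : ∑ y, ‖∑ a, h y a‖ ^ 2 ≤ ∑ p, s p := by
      have hc : ((∑ y, ‖∑ a, h y a‖ ^ 2 : ℝ) : ℂ) = ∑ p : Matrix (Fin d) (Fin d) F × Matrix (Fin d) (Fin d) F, ∑ y,
          ψ (Matrix.trace (M * (p.1 - p.2) * (List.ofFn y).prod)) * ∏ i, G p i y := by
        rw [Finset.sum_comm]
        push_cast
        refine Finset.sum_congr rfl fun y _ => ?_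
        rw [← Complex.mul_conj', map_sum, Finset.sum_mul_sum, Fintype.sum_prod_type]
        refine Finset.sum_congr rfl fun a _ => Finset.sum_congr rfl fun b _ => ?_
        simp only [h, G, map_mul, map_prod, Finset.prod_mul_distrib]
        rw [← AddChar.map_neg_eq_conj]
        have : M * (a - b) * (List.ofFn y).prod =
            M * (a * (List.ofFn y).prod) - M * (b * (List.ofFn y).prod) := by
          noncomm_ring
        rw [this, Matrix.trace_sub, sub_eq_add_neg, AddChar.map_add_eq_mul]
        ring
      calc ∑ y, ‖∑ a, h y a‖ ^ 2 = ‖((∑ y, ‖∑ a, h y a‖ ^ 2 : ℝ) : ℂ)‖ := by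
            rw [Complex.norm_real, Real.norm_of_nonneg (by positivity)]
        _ ≤ _ := by rw [hc]; exact norm_sum_le _ _
    have hcs : ‖∑ x, ψ (Matrix.trace (M * (List.ofFn x).prod)) * ∏ i, g i x‖ ^ 2 ≤
        q ^ (m + 1) * ∑ p, s p := by
      rw [hsplit]
      calc _ ≤ (∑ y, ‖∑ a, h y a‖) ^ 2 := by
            gcongr
            refine (norm_sum_le _ _).trans (Finset.sum_le_sum fun y _ => ?_)
            rw [norm_mul]
            exact mul_le_of_le_one_left (norm_nonneg _) (hg1 _ _)
        _ ≤ (Finset.univ : Finset (Fin (m + 1) → Matrix (Fin d) (Fin d) F)).card * ∑ y, ‖∑ a, h y a‖ ^ 2 :=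
            sq_sum_le_card_mul_sum_sq
        _ = q ^ (m + 1) * ∑ y, ‖∑ a, h y a‖ ^ 2 := by
            simp [hq]
        _ ≤ _ := by gcongr
    have hs0 : ∀ p, 0 ≤ s p := fun p => norm_nonneg _
    have hih : ∀ p, s p ^ 2 ^ m * q ^ m ≤
        q ^ ((m + 1) * 2 ^ m) * zeroCount m (M * (p.1 - p.2)) := by
      intro p
      refine ih (M * (p.1 - p.2)) (G p) (fun i y => ?_) (fun i y z hyz => ?_)
      · simp only [G, norm_mul, RCLike.norm_conj]
        exact mul_le_one₀ (hg1 _ _) (norm_nonneg _) (hg1 _ _)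
      · have key : ∀ a : Matrix (Fin d) (Fin d) F, g i.succ (Fin.cons a y : Fin (m + 2) → Matrix (Fin d) (Fin d) F) =
            g i.succ (Fin.cons a z : Fin (m + 2) → Matrix (Fin d) (Fin d) F) := by
          intro a
          apply hg
          intro j hj
          refine Fin.cases (fun _ => rfl) (fun j hj => ?_) j hj
          simpa using hyz j fun h => hj (by rw [h])
        simp only [G, key]
    -- Power mean inequality over the `q ^ 2` pairs.
    have hjen : (∑ p, s p) ^ 2 ^ m ≤ (q ^ 2) ^ (2 ^ m - 1) * ∑ p, s p ^ 2 ^ m := by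
      obtain ⟨e, he⟩ : ∃ e, 2 ^ m = e + 1 := ⟨2 ^ m - 1, by have := Nat.one_le_two_pow (n := m); omega⟩
      have := pow_sum_le_card_mul_sum_pow (s := (Finset.univ : Finset (Matrix (Fin d) (Fin d) F × Matrix (Fin d) (Fin d) F))) (f := s)
        (fun p _ => hs0 p) e
      rw [he, Nat.add_sub_cancel]
      refine this.trans (le_of_eq ?_)
      rw [Finset.card_univ, Fintype.card_prod]
      push_cast
      rw [← hq, sq]
    have hcount : ∑ p : Matrix (Fin d) (Fin d) F × Matrix (Fin d) (Fin d) F, (zeroCount m (M * (p.1 - p.2)) : ℝ) = q * zeroCount (m + 1) M := by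
      rw [Fintype.sum_prod_type_right]
      have : ∀ b : Matrix (Fin d) (Fin d) F, ∑ a : Matrix (Fin d) (Fin d) F, (zeroCount m (M * (a - b)) : ℝ) = zeroCount (m + 1) M := by
        intro b
        rw [zeroCount]
        push_cast
        exact (Equiv.subRight b).sum_comp fun C => (zeroCount m (M * C) : ℝ)
      simp only [this, Finset.sum_const, Finset.card_univ, nsmul_eq_mul, hq]
    obtain ⟨e, he⟩ : ∃ e, 2 ^ m = e + 1 := ⟨2 ^ m - 1, by have := Nat.one_le_two_pow (n := m); omega⟩
    calc _ = (‖∑ x, ψ (Matrix.trace (M * (List.ofFn x).prod)) * ∏ i, g i x‖ ^ 2) ^ 2 ^ m *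
            q ^ (m + 1) := by rw [← pow_mul, ← pow_succ']
      _ ≤ (q ^ (m + 1) * ∑ p, s p) ^ 2 ^ m * q ^ (m + 1) := by gcongr
      _ = (q ^ (m + 1)) ^ 2 ^ m * (∑ p, s p) ^ 2 ^ m * q ^ (m + 1) := by rw [mul_pow]
      _ ≤ (q ^ (m + 1)) ^ 2 ^ m * ((q ^ 2) ^ (2 ^ m - 1) * ∑ p, s p ^ 2 ^ m) * q ^ (m + 1) := by
          gcongr
      _ = (q ^ (m + 1)) ^ 2 ^ m * (q ^ 2) ^ (2 ^ m - 1) * q * ∑ p, (s p ^ 2 ^ m * q ^ m) := by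
          rw [← Finset.sum_mul]; ring
      _ ≤ (q ^ (m + 1)) ^ 2 ^ m * (q ^ 2) ^ (2 ^ m - 1) * q *
            ∑ p : Matrix (Fin d) (Fin d) F × Matrix (Fin d) (Fin d) F,
              (q ^ ((m + 1) * 2 ^ m) * zeroCount m (M * (p.1 - p.2)) : ℝ) := by
          exact mul_le_mul_of_nonneg_left (Finset.sum_le_sum fun p _ => hih p) (by positivity)
      _ = _ := by
          rw [← Finset.mul_sum, hcount, pow_succ 2 m, he, Nat.add_sub_cancel]
          ring

/-! ### Protocols and cylinder intersections -/

namespace NOFProtocol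

variable {ι : Type v} {X : ι → Type u}

/-- A cylinder intersection: each constraint `φ i` ignores the input of player `i`. -/
def cylinderIntersection (φ : (i : ι) → ((j : {j : ι // j ≠ i}) → X j) → Prop) :
    Set ((j : ι) → X j) :=
  {x | ∀ i, φ i (view x i)}

-- A bit of player `i` ignores the input of player `i`, so it only sharpens the constraint `φ i`.
-- Hence every node of a protocol is reached on a cylinder intersection.
open Classical in
theorem cylinderIntersection_update (φ : (i : ι) → ((j : {j : ι // j ≠ i}) → X j) → Prop)
    (i : ι) (bit : ((j : {j : ι // j ≠ i}) → X j) → Bool) (b : Bool) :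
    cylinderIntersection (Function.update φ i fun y => φ i y ∧ bit y = b) =
      {x | x ∈ cylinderIntersection φ ∧ bit (view x i) = b} := by
  ext x
  simp only [cylinderIntersection, Set.mem_ofPred_eq]
  constructor
  · intro h
    have hi := h i
    rw [Function.update_self] at hi
    refine ⟨fun j => ?_, hi.2⟩
    by_cases hj : j = i
    · subst hj
      exact hi.1
    · have := h j
      rwa [Function.update_of_ne hj] at this
  · rintro ⟨h, hb⟩ j
    by_cases hj : j = i
    · subst hj
      rw [Function.update_self]
      exact ⟨h j, hb⟩
    · rw [Function.update_of_ne hj]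
      exact h j

open Classical in
/-- If the cylinder intersections on which `f` is `1` have at most `B` points, then a protocol
that writes at most `t` bits covers at most `B * 2 ^ t` ones of `f`, and at most
`B * (2 ^ t - 1)` ones where it has to deal with a zero as well. -/
theorem card_ones_le [Finite ((j : ι) → X j)] {f : ((j : ι) → X j) → Bool} {B : ℕ}
    (hB : ∀ φ : (i : ι) → ((j : {j : ι // j ≠ i}) → X j) → Prop,
      (∀ x ∈ cylinderIntersection φ, f x = true) → (cylinderIntersection φ).ncard ≤ B)
    (P : NOFProtocol X) (t : ℕ) (φ : (i : ι) → ((j : {j : ι // j ≠ i}) → X j) → Prop)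
    (hP : ∀ x ∈ cylinderIntersection φ, P.eval x = f x ∧ P.bits x ≤ t) :
    {x | x ∈ cylinderIntersection φ ∧ f x = true}.ncard +
        (if ∃ x ∈ cylinderIntersection φ, f x = false then B else 0) ≤ B * 2 ^ t := by
  induction P generalizing t φ with
  | output z =>
    have h2 : B ≤ B * 2 ^ t := Nat.le_mul_of_pos_right _ (by positivity)
    cases z with
    | false =>
      have h0 : {x | x ∈ cylinderIntersection φ ∧ f x = true} = ∅ := by
        ext x
        simp only [Set.mem_ofPred_eq, Set.mem_empty_iff_false, iff_false, not_and]
        intro hx hf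
        have := (hP x hx).1
        simp [eval, hf] at this
      rw [h0, Set.ncard_empty, zero_add]
      split_ifs
      · exact h2
      · exact Nat.zero_le _
    | true =>
      have h1 : ∀ x ∈ cylinderIntersection φ, f x = true := fun x hx => ((hP x hx).1).symm
      rw [if_neg (by rintro ⟨x, hx, hf⟩; simp [h1 x hx] at hf), add_zero]
      refine le_trans (le_trans (Set.ncard_le_ncard ?_ (Set.toFinite _)) (hB φ h1)) h2
      exact fun x hx => hx.1
  | speak i bit next ih =>
    rcases (cylinderIntersection φ).eq_empty_or_nonempty with he | ⟨x₀, hx₀⟩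
    · simp [he]
    have ht : t ≠ 0 := by
      rintro rfl
      have := (hP x₀ hx₀).2
      simp [bits] at this
    obtain ⟨t, rfl⟩ := Nat.exists_eq_succ_of_ne_zero ht
    have key := fun b => ih b t (Function.update φ i fun y => φ i y ∧ bit y = b) (by
      intro x hx
      rw [cylinderIntersection_update] at hx
      have := hP x hx.1
      simp only [eval, bits, hx.2] at this
      exact ⟨this.1, Nat.le_of_succ_le_succ this.2⟩)
    simp only [cylinderIntersection_update, Set.mem_ofPred_eq] at key
    have hU : {x | x ∈ cylinderIntersection φ ∧ f x = true} ⊆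
        {x | (x ∈ cylinderIntersection φ ∧ bit (view x i) = true) ∧ f x = true} ∪
        {x | (x ∈ cylinderIntersection φ ∧ bit (view x i) = false) ∧ f x = true} := by
      rintro x ⟨hx, hf⟩
      cases hb : bit (view x i)
      · exact Or.inr ⟨⟨hx, hb⟩, hf⟩
      · exact Or.inl ⟨⟨hx, hb⟩, hf⟩
    have hc := (Set.ncard_le_ncard hU (Set.toFinite _)).trans (Set.ncard_union_le _ _)
    -- A zero in the node lies in one of the two children, so the extra `B` is passed on to at least
    -- one of them and finally charged to a leaf with output `false`.
    have hz : (if ∃ x ∈ cylinderIntersection φ, f x = false then B else 0) ≤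
        (if ∃ x, (x ∈ cylinderIntersection φ ∧ bit (view x i) = true) ∧ f x = false
          then B else 0) +
        (if ∃ x, (x ∈ cylinderIntersection φ ∧ bit (view x i) = false) ∧ f x = false
          then B else 0) := by
      by_cases h : ∃ x ∈ cylinderIntersection φ, f x = false
      · rw [if_pos h]
        obtain ⟨x, hx, hf⟩ := h
        cases hb : bit (view x i)
        · rw [if_pos (c := ∃ x, (x ∈ cylinderIntersection φ ∧ bit (view x i) = false) ∧ f x = false)
            ⟨x, ⟨hx, hb⟩, hf⟩]
          exact Nat.le_add_left _ _
        · rw [if_pos (c := ∃ x, (x ∈ cylinderIntersection φ ∧ bit (view x i) = true) ∧ f x = false)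
            ⟨x, ⟨hx, hb⟩, hf⟩]
          exact Nat.le_add_right _ _
      · rw [if_neg h]; exact Nat.zero_le _
    have k1 := key true
    have k2 := key false
    rw [pow_succ, ← mul_assoc]
    omega

end NOFProtocol

/-! ### Graph functions of maps with small correlation -/

open Classical in
/-- If `A` has small correlation with cylinder intersections, then there are few points `x` at
which the values `y` with `e i y x` for all `i` are exactly `A x`, where `e i` ignores the
coordinate `i`. -/
theorem card_exact_le {X F : Type*} [Fintype X] [AddCommGroup F] [Fintype F] {n : ℕ}
    (A : (Fin n → X) → F) {δ : ℝ} (hδ : 0 ≤ δ)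
    (hA : ∀ ψ : AddChar F ℂ, ψ ≠ 0 → ∀ g : Fin n → (Fin n → X) → ℂ, (∀ i x, ‖g i x‖ ≤ 1) →
      (∀ i x y, (∀ j, j ≠ i → x j = y j) → g i x = g i y) →
      ‖∑ x, ψ (A x) * ∏ i, g i x‖ ≤ δ)
    (e : Fin n → F → (Fin n → X) → Prop)
    (he : ∀ i v x y, (∀ j, j ≠ i → x j = y j) → (e i v x ↔ e i v y)) :
    (Fintype.card F : ℝ) * (Finset.univ.filter fun x => ∀ v, (∀ i, e i v x) ↔ v = A x).card ≤
      (Fintype.card X : ℝ) ^ n + (Fintype.card F : ℝ) ^ 2 * 2 ^ Fintype.card F * δ := by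
  set N := Fintype.card F with hN
  let E : F → (Fin n → X) → Prop := fun v x => ∀ w, (∀ i, e i w x) ↔ w = v
  let G : F → (Fin n → X) → ℂ := fun v x => if E v x then 1 else 0
  let D : Fin n → F → (Fin n → X) → ℂ := fun i v x => if e i v x then 1 else 0
  let g : Finset F → Fin n → (Fin n → X) → ℂ := fun T i x => ∏ v ∈ T, D i v x
  have hprod : ∀ v x, ∏ i, D i v x = if ∀ i, e i v x then 1 else 0 := by
    intro v x
    simp only [D]
    rw [Finset.prod_ite_zero]
    simp
  -- Inclusion-exclusion: with `D_w = ∏ i, D i w`, the indicator of `E v` is `D_v * ∏_{w ≠ v} (1 -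
  -- D_w)`. In each term the factors are regrouped by `i`, and `g T i` still ignores the coordinate
  -- `i`.
  have hG : ∀ v x, G v x = ∑ T ∈ (Finset.univ.erase v).powerset,
      (-1) ^ T.card * ∏ i, g (insert v T) i x := by
    intro v x
    have h1 : ∀ T ∈ (Finset.univ.erase v).powerset,
        (-1 : ℂ) ^ T.card * ∏ i, g (insert v T) i x =
          (∏ i, D i v x) * ((∏ w ∈ T, -∏ i, D i w x) * ∏ w ∈ (Finset.univ.erase v) \ T, 1) := by
      intro T hT
      have hv : v ∉ T := fun h => by simpa using Finset.mem_powerset.1 hT h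
      simp only [g]
      rw [Finset.prod_comm, Finset.prod_insert hv, Finset.prod_neg, Finset.prod_const_one]
      ring
    rw [Finset.sum_congr rfl h1, ← Finset.mul_sum, ← Finset.prod_add]
    simp only [hprod, G]
    by_cases hE : E v x
    · rw [if_pos hE, if_pos ((hE v).2 rfl), one_mul, Finset.prod_eq_one]
      intro w hw
      rw [if_neg fun h => Finset.ne_of_mem_erase hw ((hE w).1 h)]
      simp
    · rw [if_neg hE]
      by_cases hv : ∀ i, e i v x
      · have : ∃ w, w ≠ v ∧ ∀ i, e i w x := by
          by_contra! hcon
          refine hE fun w => ⟨fun hw => ?_, fun hw => hw ▸ hv⟩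
          by_contra hne
          obtain ⟨i, hi⟩ := hcon w hne
          exact hi (hw i)
        obtain ⟨w, hwv, hw⟩ := this
        rw [Finset.prod_eq_zero (Finset.mem_erase.2 ⟨hwv, Finset.mem_univ w⟩), mul_zero]
        rw [if_pos hw]; simp
      · rw [if_neg hv, zero_mul]
  have hcorr : ∀ ψ : AddChar F ℂ, ψ ≠ 0 → ∀ v, ‖∑ x, ψ (A x) * G v x‖ ≤ 2 ^ N * δ := by
    intro ψ hψ v
    have hterm : ∀ T : Finset F, ‖∑ x, ψ (A x) * ∏ i, g T i x‖ ≤ δ := by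
      intro T
      refine hA ψ hψ (g T) (fun i x => ?_) (fun i x y hxy => ?_)
      · simp only [g, norm_prod]
        refine Finset.prod_le_one (fun _ _ => norm_nonneg _) fun w _ => ?_
        simp only [D]
        split_ifs <;> simp
      · simp only [g, D, he i _ x y hxy]
    have : ∑ x, ψ (A x) * G v x = ∑ T ∈ (Finset.univ.erase v).powerset,
        (-1) ^ T.card * ∑ x, ψ (A x) * ∏ i, g (insert v T) i x := by
      simp_rw [hG, Finset.mul_sum]
      rw [Finset.sum_comm]
      refine Finset.sum_congr rfl fun T _ => Finset.sum_congr rfl fun x _ => by ring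
    rw [this]
    calc _ ≤ ∑ T ∈ (Finset.univ.erase v).powerset, δ := by
          refine (norm_sum_le _ _).trans (Finset.sum_le_sum fun T _ => ?_)
          rw [norm_mul, norm_pow, norm_neg, norm_one, one_pow, one_mul]
          exact hterm _
      _ = 2 ^ (N - 1) * δ := by
          rw [Finset.sum_const, Finset.card_powerset, Finset.card_erase_of_mem (Finset.mem_univ v),
            Finset.card_univ, nsmul_eq_mul]
          push_cast
          rfl
      _ ≤ _ := by
          gcongr
          · norm_num
          · omega
  -- The condition `A x = v` is expanded in the characters of `F`. The trivial one gives the size of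
  -- `E v`, the others are bounded by `hcorr`.
  have hone : ∀ v, (N : ℝ) * (Finset.univ.filter fun x => A x = v ∧ E v x).card ≤
      (Finset.univ.filter fun x => E v x).card + N * (2 ^ N * δ) := by
    intro v
    have h1 : ((N : ℝ) * (Finset.univ.filter fun x => A x = v ∧ E v x).card : ℂ) =
        ∑ ψ : AddChar F ℂ, ψ (-v) * ∑ x, ψ (A x) * G v x := by
      simp_rw [Finset.mul_sum]
      rw [Finset.sum_comm]
      have h2 : ∀ x, ∑ ψ : AddChar F ℂ, ψ (-v) * (ψ (A x) * G v x) =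
          if A x = v ∧ E v x then (N : ℂ) else 0 := by
        intro x
        simp_rw [← mul_assoc, ← AddChar.map_add_eq_mul, ← Finset.sum_mul]
        rw [AddChar.sum_apply_eq_ite]
        have h3 : -v + A x = 0 ↔ A x = v := by
          rw [neg_add_eq_zero, eq_comm]
        simp only [h3, G, ← hN, ite_and]
        split_ifs <;> simp
      simp_rw [h2]
      rw [← Finset.sum_filter, Finset.sum_const, nsmul_eq_mul]
      push_cast
      ring
    rw [← Finset.add_sum_erase _ _ (Finset.mem_univ (0 : AddChar F ℂ))] at h1
    have h0 : (0 : AddChar F ℂ) (-v) * ∑ x, (0 : AddChar F ℂ) (A x) * G v x =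
        ((Finset.univ.filter fun x => E v x).card : ℂ) := by
      simp only [AddChar.zero_apply, one_mul, G]
      rw [← Finset.sum_filter, Finset.sum_const, nsmul_eq_mul, mul_one]
    rw [h0] at h1
    have hnorm := congrArg norm h1
    rw [norm_mul, Complex.norm_real, Complex.norm_natCast, Real.norm_natCast] at hnorm
    rw [hnorm]
    refine (norm_add_le _ _).trans ?_
    rw [Complex.norm_natCast]
    gcongr
    calc _ ≤ ∑ ψ ∈ Finset.univ.erase (0 : AddChar F ℂ), 2 ^ N * δ := by
          refine (norm_sum_le _ _).trans (Finset.sum_le_sum fun ψ hψ => ?_)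
          rw [norm_mul, AddChar.norm_apply, one_mul]
          exact hcorr ψ (Finset.ne_of_mem_erase hψ) v
      _ ≤ ∑ ψ : AddChar F ℂ, 2 ^ N * δ := by
          refine Finset.sum_le_sum_of_subset_of_nonneg (Finset.erase_subset _ _) fun ψ _ _ => ?_
          positivity
      _ = N * (2 ^ N * δ) := by
          rw [Finset.sum_const, Finset.card_univ, nsmul_eq_mul, AddChar.card_eq, hN]
  have hsumE : ∑ v, ((Finset.univ.filter fun x => E v x).card : ℝ) ≤ (Fintype.card X : ℝ) ^ n := by
    have hdisj : Set.PairwiseDisjoint (↑(Finset.univ : Finset F))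
        fun v => Finset.univ.filter fun x => E v x := by
      intro v _ w _ hvw
      rw [Function.onFun, Finset.disjoint_filter]
      intro x _ hv hw
      exact hvw ((hw v).1 ((hv v).2 rfl))
    rw [← Nat.cast_sum, ← Finset.card_biUnion hdisj]
    calc _ ≤ ((Fintype.card (Fin n → X) : ℕ) : ℝ) := by exact_mod_cast Finset.card_le_univ _
      _ = _ := by simp
  have hU : (Finset.univ.filter fun x => ∀ v, (∀ i, e i v x) ↔ v = A x) =
      Finset.univ.biUnion fun v => Finset.univ.filter fun x => A x = v ∧ E v x := by
    ext x
    simp [E]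
  calc _ ≤ (N : ℝ) * ∑ v, ((Finset.univ.filter fun x => A x = v ∧ E v x).card : ℝ) := by
        rw [hU]
        gcongr
        exact_mod_cast Finset.card_biUnion_le
    _ ≤ ∑ v, ((Finset.univ.filter fun x => E v x).card + N * (2 ^ N * δ)) := by
        rw [Finset.mul_sum]
        exact Finset.sum_le_sum fun v _ => hone v
    _ = ∑ v, ((Finset.univ.filter fun x => E v x).card : ℝ) + N * (N * (2 ^ N * δ)) := by
        rw [Finset.sum_add_distrib, Finset.sum_const, Finset.card_univ, nsmul_eq_mul]
    _ ≤ (Fintype.card X : ℝ) ^ n + N * (N * (2 ^ N * δ)) := by gcongr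
    _ = _ := by ring

/-- The input of a graph function made of `x₁, …, xₙ` and `y`. -/
def graphPoint {X F : Type u} {n : ℕ} (x : Fin n → X) (y : F) :
    (j : Option (Fin n)) → GraphInput n X F j
  | some i => x i
  | none => y

open Classical NOFProtocol in
/-- The same bound for cylinder intersections inside the graph of `A`. -/
theorem ncard_cylinderIntersection_le {X F : Type u} [Fintype X] [AddCommGroup F] [Fintype F]
    {n : ℕ} (A : (Fin n → X) → F) {δ : ℝ} (hδ : 0 ≤ δ)
    (hA : ∀ ψ : AddChar F ℂ, ψ ≠ 0 → ∀ g : Fin n → (Fin n → X) → ℂ, (∀ i x, ‖g i x‖ ≤ 1) →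
      (∀ i x y, (∀ j, j ≠ i → x j = y j) → g i x = g i y) →
      ‖∑ x, ψ (A x) * ∏ i, g i x‖ ≤ δ)
    (φ : (i : Option (Fin n)) → ((j : {j // j ≠ i}) → GraphInput n X F j) → Prop)
    (hφ : ∀ z ∈ cylinderIntersection φ, Lift A z = true) :
    (Fintype.card F : ℝ) * (cylinderIntersection φ).ncard ≤
      (Fintype.card X : ℝ) ^ n + (Fintype.card F : ℝ) ^ 2 * 2 ^ Fintype.card F * δ := by
  have hz : ∀ z : (j : Option (Fin n)) → GraphInput n X F j,
      graphPoint (fun i => z (some i)) (z none) = z := by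
    intro z
    funext j
    cases j <;> rfl
  have hval : ∀ z ∈ cylinderIntersection φ, A (fun i => z (some i)) = z none := fun z h => by
    simpa [Lift] using hφ z h
  refine le_trans ?_ (card_exact_le A hδ hA
    (fun i v x => φ (some i) (view (graphPoint x v) (some i))) ?_)
  · gcongr
    rw [← Set.ncard_coe_finset]
    refine Set.ncard_le_ncard_of_injOn (fun z i => z (some i)) ?_ ?_ (Set.toFinite _)
    · intro z hzC
      simp only [Finset.coe_filter, Finset.mem_univ, true_and]
      intro v
      constructor
      · intro hv
        -- Player `none` does not see the last input, so replacing it by an allowed `v` stays in the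
        -- cylinder intersection. As this lies in the graph, `v` is the value of `A`.
        have hmem : graphPoint (fun i => z (some i)) v ∈ cylinderIntersection φ := by
          intro j
          cases j with
          | some i => exact hv i
          | none =>
            have : view (graphPoint (fun i => z (some i)) v) none = view z none := by
              funext j
              obtain ⟨j, hj⟩ := j
              cases j with
              | none => exact absurd rfl hj
              | some i => rfl
            rw [this]
            exact hzC none
        exact (hval _ hmem).symm
      · rintro rfl i
        rw [hval z hzC]
        exact (congrArg (fun w => φ (some i) (view w (some i))) (hz z)).mpr (hzC (some i))
    · intro z hzC w hwC hzw
      rw [← hz z, ← hz w, ← hval z hzC, ← hval w hwC]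
      simp only at hzw
      rw [hzw]
  · intro i v x y hxy
    have : view (graphPoint x v) (some i) = view (graphPoint y v) (some i) := by
      funext j
      obtain ⟨j, hj⟩ := j
      cases j with
      | none => rfl
      | some j => exact hxy j fun h => hj (by rw [h])
    rw [this]

open Classical NOFProtocol in
/-- A function whose correlation with cylinder intersections is small has a graph function of
large deterministic number-on-the-forehead complexity. -/
theorem card_le_two_pow_detNOF_lift {X F : Type u} [Fintype X] [Nonempty X] [AddCommGroup F]
    [Fintype F] [Nontrivial F] {n : ℕ} (hn : n ≠ 0) (A : (Fin n → X) → F)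
    (hA : ∀ ψ : AddChar F ℂ, ψ ≠ 0 → ∀ g : Fin n → (Fin n → X) → ℂ, (∀ i x, ‖g i x‖ ≤ 1) →
      (∀ i x y, (∀ j, j ≠ i → x j = y j) → g i x = g i y) →
      ‖∑ x, ψ (A x) * ∏ i, g i x‖ ≤ (Fintype.card X : ℝ) ^ n / 2 ^ (4 * Fintype.card F)) :
    Fintype.card F ≤ 2 ^ detNOF (Lift A) := by
  set N := Fintype.card F with hN
  have hN1 : 1 < N := Fintype.one_lt_card
  have hX0 : (0 : ℝ) < (Fintype.card X : ℝ) ^ n := by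
    have : 0 < Fintype.card X := Fintype.card_pos
    positivity
  have hfin : ∀ j, Finite (GraphInput n X F j) := by
    intro j
    cases j with
    | none => exact inferInstanceAs (Finite F)
    | some i => exact inferInstanceAs (Finite X)
  have hnt : Nontrivial (Option (Fin n)) := by
    have : Nonempty (Fin n) := ⟨⟨0, Nat.pos_of_ne_zero hn⟩⟩
    infer_instance
  -- The infimum is attained, so the default value `0` of `sInf ∅` plays no role; `hn` supplies the
  -- second player.
  obtain ⟨P, hP⟩ := exists_protocol_detNOF (Lift A)
  set t := detNOF (Lift A)
  set η : ℝ := (N : ℝ) ^ 2 * 2 ^ N / 2 ^ (4 * N) with hη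
  have hη0 : 0 ≤ η := by positivity
  set B : ℕ := ⌊(Fintype.card X : ℝ) ^ n * (1 + η) / N⌋₊ with hBdef
  have hB := card_ones_le (f := Lift A) (B := B) (fun φ hφ => by
    have := ncard_cylinderIntersection_le A (by positivity) hA φ hφ
    apply Nat.le_floor
    rw [le_div_iff₀ (by positivity), mul_comm]
    refine this.trans (le_of_eq ?_)
    rw [hη]
    ring) P t (fun _ _ => True) (fun z _ => hP z)
  have huniv : ∀ z, z ∈ cylinderIntersection
      (fun (i : Option (Fin n)) (_ : (j : {j // j ≠ i}) → GraphInput n X F j) => True) :=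
    fun z i => trivial
  have hzero : ∃ z ∈ cylinderIntersection
      (fun (i : Option (Fin n)) (_ : (j : {j // j ≠ i}) → GraphInput n X F j) => True),
      Lift A z = false := by
    let x : Fin n → X := fun _ => Classical.arbitrary X
    obtain ⟨y, hy⟩ := exists_ne (A x)
    refine ⟨graphPoint x y, huniv _, ?_⟩
    have : A (fun i => graphPoint x y (some i)) ≠ graphPoint x y none := hy.symm
    simpa [Lift] using this
  rw [if_pos hzero] at hB
  have hones : Fintype.card X ^ n ≤ {z | z ∈ cylinderIntersection
      (fun (i : Option (Fin n)) (_ : (j : {j // j ≠ i}) → GraphInput n X F j) => True) ∧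
      Lift A z = true}.ncard := by
    have : Fintype.card X ^ n = (Set.univ : Set (Fin n → X)).ncard := by
      simp [Set.ncard_univ]
    rw [this]
    refine Set.ncard_le_ncard_of_injOn (fun x => graphPoint x (A x)) ?_ ?_ (Set.toFinite _)
    · intro x _
      refine ⟨huniv _, ?_⟩
      have : A (fun i => graphPoint x (A x) (some i)) = graphPoint x (A x) none := rfl
      simpa [Lift] using this
    · intro x _ y _ hxy
      funext i
      exact congrFun hxy (some i)
  -- If `2 ^ t ≤ N - 1`, covering the graph gives `|X| ^ n ≤ B * (N - 2)`, one `B` being lost to a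
  -- zero. Hence `N ≤ (1 + η) * (N - 2)`, against `η * N ≤ 1`.
  by_contra! hlt
  have hcount : Fintype.card X ^ n + B ≤ B * (N - 1) := by
    refine (Nat.add_le_add_right hones B).trans (hB.trans ?_)
    exact Nat.mul_le_mul_left _ (by omega)
  have hcountR : (Fintype.card X : ℝ) ^ n ≤ B * ((N : ℝ) - 2) := by
    have h : ((Fintype.card X ^ n + B : ℕ) : ℝ) ≤ ((B * (N - 1) : ℕ) : ℝ) := by exact_mod_cast hcount
    push_cast [Nat.cast_sub hN1.le] at h
    linarith
  have hBle : (B : ℝ) * N ≤ (Fintype.card X : ℝ) ^ n * (1 + η) := by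
    have := Nat.floor_le (a := (Fintype.card X : ℝ) ^ n * (1 + η) / N) (by positivity)
    rwa [le_div_iff₀ (by positivity)] at this
  have hηN : η * N ≤ 1 := by
    have h2 : (N : ℝ) ≤ 2 ^ N := by exact_mod_cast Nat.lt_two_pow_self.le
    rw [hη, div_mul_eq_mul_div, div_le_one (by positivity)]
    calc (N : ℝ) ^ 2 * 2 ^ N * N ≤ (2 ^ N) ^ 2 * 2 ^ N * 2 ^ N := by gcongr
      _ = 2 ^ (4 * N) := by ring
  have hN2 : (0 : ℝ) ≤ (N : ℝ) - 2 := by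
    have : (2 : ℝ) ≤ N := by exact_mod_cast hN1
    linarith
  have h3 : (Fintype.card X : ℝ) ^ n * N ≤ (Fintype.card X : ℝ) ^ n * ((1 + η) * (N - 2)) := by
    calc _ ≤ B * ((N : ℝ) - 2) * N := by gcongr
      _ = (B * N) * ((N : ℝ) - 2) := by ring
      _ ≤ ((Fintype.card X : ℝ) ^ n * (1 + η)) * (N - 2) := by gcongr
      _ = _ := by ring
  have h4 := le_of_mul_le_mul_left h3 hX0
  nlinarith

/-! ### Choice of the parameters and conclusion -/

/-- The correlation of the trace of a product of matrices with cylinder intersections. -/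
theorem norm_sum_traceProd_le {F : Type*} [Field F] [Fintype F] {d m s : ℕ} (hs : m * s < d)
    (hbig : m * 2 ^ d * 2 ^ (4 * Fintype.card F * 2 ^ m) ≤ Fintype.card F ^ ((s + 1) ^ 2))
    (ψ : AddChar F ℂ) (hψ : ψ ≠ 0)
    (g : Fin (m + 1) → (Fin (m + 1) → Matrix (Fin d) (Fin d) F) → ℂ)
    (hg1 : ∀ i x, ‖g i x‖ ≤ 1)
    (hg : ∀ i x y, (∀ j, j ≠ i → x j = y j) → g i x = g i y) :
    ‖∑ x, ψ (traceProd F d (m + 1) x) * ∏ i, g i x‖ ≤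
      (Fintype.card (Matrix (Fin d) (Fin d) F) : ℝ) ^ (m + 1) / 2 ^ (4 * Fintype.card F) := by
  classical
  have hbns := norm_sum_mul_prod_pow_le hψ m 1 g hg1 hg
  simp only [one_mul] at hbns
  change ‖∑ x, ψ (Matrix.trace (List.ofFn x).prod) * ∏ i, g i x‖ ≤ _
  set S := ‖∑ x, ψ (Matrix.trace (List.ofFn x).prod) * ∏ i, g i x‖
  have hzero := zeroCount_mul_card_le (s := s) m (1 : Matrix (Fin d) (Fin d) F)
    (by rw [Matrix.rank_one, Fintype.card_fin]; exact hs)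
  have hcor := card_corank_le (F := F) d (s + 1)
  set Z := (Finset.univ.filter fun C : Matrix (Fin d) (Fin d) F => C.rank + (s + 1) ≤ d).card
  have hq : Fintype.card (Matrix (Fin d) (Fin d) F) = Fintype.card F ^ (d ^ 2) := by
    rw [Fintype.card_congr Matrix.of.symm]
    simp [← pow_mul, sq]
  rw [← hq] at hcor
  set q := Fintype.card (Matrix (Fin d) (Fin d) F)
  set N := Fintype.card F
  have hq0 : 0 < q := Fintype.card_pos
  have hN0 : 0 < N := Fintype.card_pos
  have hZ : zeroCount m (1 : Matrix (Fin d) (Fin d) F) * N ^ ((s + 1) ^ 2) ≤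
      m * 2 ^ d * q ^ m := by
    refine Nat.le_of_mul_le_mul_right ?_ hq0
    calc _ = zeroCount m (1 : Matrix (Fin d) (Fin d) F) * q * N ^ ((s + 1) ^ 2) := by ring
      _ ≤ m * Z * q ^ m * N ^ ((s + 1) ^ 2) := by gcongr
      _ = m * q ^ m * (Z * N ^ ((s + 1) ^ 2)) := by ring
      _ ≤ m * q ^ m * (2 ^ d * q) := by gcongr
      _ = _ := by ring
  have hZ2 : zeroCount m (1 : Matrix (Fin d) (Fin d) F) * 2 ^ (4 * N * 2 ^ m) ≤ q ^ m := by
    have h1 : zeroCount m (1 : Matrix (Fin d) (Fin d) F) * (m * 2 ^ d * 2 ^ (4 * N * 2 ^ m)) ≤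
        m * 2 ^ d * q ^ m := (Nat.mul_le_mul_left _ hbig).trans hZ
    -- For `m = 0` the factor `m` cannot be cancelled, but `hZ` already says that the count is zero.
    rcases Nat.eq_zero_or_pos m with rfl | hm
    · have : zeroCount 0 (1 : Matrix (Fin d) (Fin d) F) = 0 := by
        have := Nat.pos_of_ne_zero (pow_pos hN0 ((s + 1) ^ 2)).ne'
        have h2 : zeroCount 0 (1 : Matrix (Fin d) (Fin d) F) * N ^ ((s + 1) ^ 2) = 0 := by
          simpa using hZ
        exact (Nat.mul_eq_zero.1 h2).resolve_right this.ne'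
      simp [this]
    · refine Nat.le_of_mul_le_mul_left ?_ (show 0 < m * 2 ^ d by positivity)
      calc _ = zeroCount m (1 : Matrix (Fin d) (Fin d) F) * (m * 2 ^ d * 2 ^ (4 * N * 2 ^ m)) := by
            ring
        _ ≤ _ := h1
  have hZR : (zeroCount m (1 : Matrix (Fin d) (Fin d) F) : ℝ) * 2 ^ (4 * N * 2 ^ m) ≤
      (q : ℝ) ^ m := by exact_mod_cast hZ2
  rw [le_div_iff₀ (by positivity)]
  -- The factor `2 ^ m` in the exponent of `hZ2` pays for taking the `2 ^ m`-th root.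
  refine le_of_pow_le_pow_left₀ (n := 2 ^ m) (by positivity) (by positivity) ?_
  refine le_of_mul_le_mul_right ?_ (show (0 : ℝ) < (q : ℝ) ^ m by positivity)
  calc (S * 2 ^ (4 * N)) ^ 2 ^ m * (q : ℝ) ^ m
      = S ^ 2 ^ m * q ^ m * 2 ^ (4 * N * 2 ^ m) := by rw [mul_pow, ← pow_mul]; ring
    _ ≤ (q : ℝ) ^ ((m + 1) * 2 ^ m) * zeroCount m (1 : Matrix (Fin d) (Fin d) F) *
          2 ^ (4 * N * 2 ^ m) := by gcongr
    _ = (q : ℝ) ^ ((m + 1) * 2 ^ m) *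
          (zeroCount m (1 : Matrix (Fin d) (Fin d) F) * 2 ^ (4 * N * 2 ^ m)) := by ring
    _ ≤ (q : ℝ) ^ ((m + 1) * 2 ^ m) * q ^ m := by gcongr
    _ = _ := by rw [pow_mul]

/-- The square of the size of the matrices, up to rounding and the constant, is
`k ^ 3 * 2 ^ k * (N / log N)`. -/
theorem matrix_size_sq {N k : ℕ} (hN : 2 ≤ N) :
    ((k : ℝ) ^ (3 / 2 : ℝ) * (2 : ℝ) ^ ((k : ℝ) / 2) * Real.sqrt ((N : ℝ) / Real.logb 2 N)) ^ 2 *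
      Real.logb 2 N = (k : ℝ) ^ 3 * 2 ^ k * N := by
  have hL : 0 < Real.logb 2 N :=
    Real.logb_pos (by norm_num) (by exact_mod_cast hN)
  rw [mul_pow, mul_pow, Real.sq_sqrt (by positivity), ← Real.rpow_mul_natCast (by positivity),
    ← Real.rpow_mul_natCast (by norm_num)]
  have h1 : (3 / 2 : ℝ) * (2 : ℕ) = (3 : ℕ) := by norm_num
  have h2 : (k : ℝ) / 2 * (2 : ℕ) = (k : ℕ) := by norm_num
  rw [h1, h2, Real.rpow_natCast, Real.rpow_natCast]
  field_simp

theorem one_le_logb_two {N : ℕ} (hN : 2 ≤ N) : 1 ≤ Real.logb 2 N := by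
  rw [Real.le_logb_iff_rpow_le (by norm_num) (by positivity), Real.rpow_one]
  exact_mod_cast hN

theorem logb_two_le_self (N : ℕ) : Real.logb 2 N ≤ N := by
  rcases Nat.eq_zero_or_pos N with rfl | h
  · simp
  · rw [Real.logb_le_iff_le_rpow (by norm_num) (by positivity), Real.rpow_natCast]
    exact_mod_cast Nat.lt_two_pow_self.le

/-- The matrices are large enough for the correlation bound. -/
theorem matrix_size_large {N m d s : ℕ} {c P : ℝ} (hc : 2 ≤ c) (hN : 2 ≤ N)
    (hP0 : 0 < P) (hP : P ^ 2 * Real.logb 2 N = ((m + 2 : ℕ) : ℝ) ^ 3 * 2 ^ (m + 2) * N)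
    (hd : c * P ≤ d) (hs : d ≤ (s + 1) * (m + 2)) :
    m * 2 ^ d * 2 ^ (4 * N * 2 ^ m) ≤ N ^ ((s + 1) ^ 2) := by
  set L := Real.logb 2 N with hLdef
  have hL : 1 ≤ L := one_le_logb_two hN
  set k : ℕ := m + 2 with hk
  have hk2 : (2 : ℝ) ≤ k := by rw [hk]; push_cast; linarith [(Nat.cast_nonneg m : (0 : ℝ) ≤ m)]
  have hkk : (k : ℝ) ≤ 2 ^ k := by exact_mod_cast Nat.lt_two_pow_self.le
  have hNR : (2 : ℝ) ≤ N := by exact_mod_cast hN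
  have hLN : L ≤ N := logb_two_le_self N
  have hdP : 2 * P ≤ d := by nlinarith
  have hd0 : (0 : ℝ) < d := by linarith
  have hPL : (k : ℝ) ^ 2 ≤ P * L := by
    refine le_of_pow_le_pow_left₀ (n := 2) (by norm_num) (by positivity) ?_
    calc ((k : ℝ) ^ 2) ^ 2 = (k : ℝ) ^ 3 * k * 1 * 1 := by ring
      _ ≤ (k : ℝ) ^ 3 * 2 ^ k * N * L := by gcongr; linarith
      _ = (P * L) ^ 2 := by rw [← hP]; ring
  -- One half of `d ^ 2 * L` absorbs the factor `2 ^ d`, the other half absorbs `m` and `2 ^ (4 * N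
  -- * 2 ^ m)`, where `4 * 2 ^ m = 2 ^ k`.
  have hhalf1 : 2 * (k : ℝ) ^ 2 * d ≤ d ^ 2 * L := by
    calc 2 * (k : ℝ) ^ 2 * d ≤ 2 * (P * L) * d := by gcongr
      _ = (2 * P) * L * d := by ring
      _ ≤ d * L * d := by gcongr
      _ = _ := by ring
  have hhalf2 : 2 * (k : ℝ) ^ 2 * (2 * k * 2 ^ k * N) ≤ d ^ 2 * L := by
    calc 2 * (k : ℝ) ^ 2 * (2 * k * 2 ^ k * N) = (2 * P) ^ 2 * L := by
          rw [mul_pow, mul_assoc _ (P ^ 2), hP]; ring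
      _ ≤ _ := by gcongr
  have hsum : (k : ℝ) ^ 2 * (d + 2 * k * 2 ^ k * N) ≤ (k : ℝ) ^ 2 * (((s : ℝ) + 1) ^ 2 * L) := by
    have hsR : (d : ℝ) ≤ ((s : ℝ) + 1) * k := by exact_mod_cast hs
    calc (k : ℝ) ^ 2 * (d + 2 * k * 2 ^ k * N) ≤ d ^ 2 * L := by linarith
      _ ≤ (((s : ℝ) + 1) * k) ^ 2 * L := by gcongr
      _ = _ := by ring
  have hmain : (d : ℝ) + 2 * k * 2 ^ k * N ≤ ((s : ℝ) + 1) ^ 2 * L :=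
    le_of_mul_le_mul_left hsum (by positivity)
  have hexp : ((m + d + 4 * N * 2 ^ m : ℕ) : ℝ) ≤ L * (((s + 1) ^ 2 : ℕ) : ℝ) := by
    have h1 : (1 : ℝ) ≤ 2 ^ k * N := by
      have : (1 : ℝ) ≤ 2 ^ k := one_le_pow₀ (by norm_num)
      nlinarith
    have h2 : ((4 * N * 2 ^ m : ℕ) : ℝ) = 2 ^ k * N := by
      rw [hk]; push_cast; ring
    have h3 : (m : ℝ) ≤ k := by rw [hk]; push_cast; linarith
    push_cast at h2 ⊢
    rw [h2]
    nlinarith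
  have hNpow : (N : ℝ) ^ ((s + 1) ^ 2) = (2 : ℝ) ^ (L * (((s + 1) ^ 2 : ℕ) : ℝ)) := by
    rw [Real.rpow_mul (by norm_num), hLdef, Real.rpow_logb (by norm_num) (by norm_num) (by positivity),
      Real.rpow_natCast]
  have hfin : 2 ^ (m + d + 4 * N * 2 ^ m) ≤ N ^ ((s + 1) ^ 2) := by
    have : (2 : ℝ) ^ (m + d + 4 * N * 2 ^ m) ≤ (N : ℝ) ^ ((s + 1) ^ 2) := by
      rw [hNpow, ← Real.rpow_natCast]
      exact Real.rpow_le_rpow_of_exponent_le (by norm_num) hexp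
    exact_mod_cast this
  refine le_trans ?_ hfin
  rw [pow_add, pow_add]
  gcongr
  exact Nat.lt_two_pow_self.le

/-- The upper bound for `log log n` in terms of `N` and `k`. -/
theorem logb_logb_card_le {N k d n : ℕ} {c P : ℝ} (hc : 0 ≤ c) (hN : 2 ≤ N) (hk : 2 ≤ k)
    (hP1 : 1 ≤ P) (hP : P ^ 2 * Real.logb 2 N = (k : ℝ) ^ 3 * 2 ^ k * N)
    (hd0 : 0 < d) (hd : (d : ℝ) ≤ c * P + 1) (hn : n = N ^ (d ^ 2)) :
    Real.logb 2 (Real.logb 2 n) ≤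
      Real.logb 2 N + k + 3 * Real.logb 2 k + 2 * Real.logb 2 (c + 1) := by
  have hL : 1 ≤ Real.logb 2 N := one_le_logb_two hN
  have hlog : Real.logb 2 n = (d : ℝ) ^ 2 * Real.logb 2 N := by
    rw [hn]
    push_cast
    rw [Real.logb_pow]
    push_cast
    rfl
  have hle : (d : ℝ) ^ 2 * Real.logb 2 N ≤ (c + 1) ^ 2 * ((k : ℝ) ^ 3 * 2 ^ k * N) := by
    -- Since `P ≥ 1`, the rounding is absorbed by `c * P + 1 ≤ (c + 1) * P`.
    calc (d : ℝ) ^ 2 * Real.logb 2 N ≤ ((c + 1) * P) ^ 2 * Real.logb 2 N := by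
          gcongr
          linarith
      _ = _ := by rw [← hP]; ring
  have hd0' : (0 : ℝ) < d := by exact_mod_cast hd0
  have hk0 : (0 : ℝ) < k := by positivity
  have hN0 : (0 : ℝ) < N := by positivity
  have h := Real.logb_le_logb_of_le (b := 2) (by norm_num) (by positivity) hle
  rw [← hlog] at h
  refine h.trans (le_of_eq ?_)
  rw [Real.logb_mul (by positivity) (by positivity), Real.logb_mul (by positivity) (by positivity),
    Real.logb_mul (by positivity) (by positivity), Real.logb_pow, Real.logb_pow, Real.logb_pow,
    Real.logb_self_eq_one (by norm_num)]
  push_cast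
  ring

theorem corollary5 :
    ∃ c₀ : ℝ, 0 < c₀ ∧ ∀ c : ℝ, c₀ ≤ c → ∀ a : ℝ, ∃ δ : ℝ, 0 < δ ∧
      ∀ (N : ℕ), IsPrimePow N → ∀ (k : ℕ), 2 ≤ k →
      ∀ (F : Type) [Field F] [Fintype F], Fintype.card F = N →
      ∀ (d : ℕ), d = ⌈c * (k : ℝ) ^ (3 / 2 : ℝ) * (2 : ℝ) ^ ((k : ℝ) / 2) *
          Real.sqrt ((N : ℝ) / Real.logb 2 N)⌉₊ →
      ∀ (n : ℕ), n = Nat.card (Matrix (Fin d) (Fin d) F) →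
        Real.logb 2 N ≤ (detNOF (Lift (traceProd F d (k - 1))) : ℝ) ∧
        Real.logb 2 (Real.logb 2 n) - k - 3 * Real.logb 2 k - 2 * Real.logb 2 (c + 1)
          ≤ Real.logb 2 N ∧
        ((k : ℝ) ≤ (N : ℝ) ^ a →
          δ * (Real.logb 2 (Real.logb 2 n) - k) ≤ Real.logb 2 N) ∧
        ((k : ℝ) ≤ a * Real.logb 2 N →
          δ * Real.logb 2 (Real.logb 2 n) ≤ Real.logb 2 N) := by
  -- The value `2` is what `matrix_size_large` needs for `2 * P ≤ d`.
  refine ⟨2, by norm_num, fun c hc a => ?_⟩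
  have hlogc : 0 ≤ Real.logb 2 (c + 1) := Real.logb_nonneg (by norm_num) (by linarith)
  -- The coefficient `4` comes from `k + 3 * log k ≤ 4 * k` in the last claim; the third needs only
  -- `3`. The constant term is scaled up by `log N ≥ 1`.
  refine ⟨1 / (1 + 4 * |a| + 2 * Real.logb 2 (c + 1)), by positivity, ?_⟩
  intro N hN k hk F _ _ hF d hd n hn
  have hN2 : 2 ≤ N := hN.two_le
  have hL : 1 ≤ Real.logb 2 N := one_le_logb_two hN2
  have hk2 : (2 : ℝ) ≤ k := by exact_mod_cast hk
  set P : ℝ := (k : ℝ) ^ (3 / 2 : ℝ) * (2 : ℝ) ^ ((k : ℝ) / 2) *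
    Real.sqrt ((N : ℝ) / Real.logb 2 N) with hPdef
  have hPsq : P ^ 2 * Real.logb 2 N = (k : ℝ) ^ 3 * 2 ^ k * N := matrix_size_sq hN2
  have hP1 : 1 ≤ P := by
    have h1 : (1 : ℝ) ≤ (k : ℝ) ^ (3 / 2 : ℝ) :=
      Real.one_le_rpow (by linarith) (by norm_num)
    have h2 : (1 : ℝ) ≤ (2 : ℝ) ^ ((k : ℝ) / 2) := Real.one_le_rpow (by norm_num) (by positivity)
    have h3 : 1 ≤ Real.sqrt ((N : ℝ) / Real.logb 2 N) := by
      rw [Real.one_le_sqrt, one_le_div (by linarith)]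
      exact logb_two_le_self N
    exact one_le_mul_of_one_le_of_one_le (one_le_mul_of_one_le_of_one_le h1 h2) h3
  have hd' : d = ⌈c * P⌉₊ := by rw [hd, hPdef]; congr 1; ring
  have hd1 : c * P ≤ d := hd' ▸ Nat.le_ceil _
  have hd2 : (d : ℝ) ≤ c * P + 1 := hd' ▸ (Nat.ceil_lt_add_one (by positivity)).le
  have hd0 : 0 < d := by
    have : (0 : ℝ) < d := lt_of_lt_of_le (by positivity) hd1
    exact_mod_cast this
  have hn' : n = N ^ (d ^ 2) := by
    rw [hn, Nat.card_eq_fintype_card, Fintype.card_congr Matrix.of.symm, ← hF]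
    simp [← pow_mul, sq]
  have hloglog := logb_logb_card_le (by linarith) hN2 hk hP1 hPsq hd0 hd2 hn'
  have hK : 0 < 1 + 4 * |a| + 2 * Real.logb 2 (c + 1) := by positivity
  have hscale : 2 * Real.logb 2 (c + 1) ≤ 2 * Real.logb 2 (c + 1) * Real.logb 2 N :=
    le_mul_of_one_le_right (by positivity) hL
  have haL : 0 ≤ |a| * Real.logb 2 N := by positivity
  have habs : a * Real.logb 2 N ≤ |a| * Real.logb 2 N := by
    gcongr
    exact le_abs_self a
  refine ⟨?_, by linarith, fun hka => ?_, fun hka => ?_⟩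
  · obtain ⟨m, rfl⟩ : ∃ m, k = m + 2 := ⟨k - 2, by omega⟩
    -- For `m > 0` this is the largest `s` with `m * s < d`. For `m = 0` the quotient is `0` and
    -- `hbig` has left side `0`.
    have hs1 : m * ((d - 1) / m) < d := lt_of_le_of_lt (Nat.mul_div_le _ _) (by omega)
    have hbig : m * 2 ^ d * 2 ^ (4 * N * 2 ^ m) ≤ N ^ (((d - 1) / m + 1) ^ 2) := by
      rcases Nat.eq_zero_or_pos m with rfl | hm
      · simp
      · refine matrix_size_large hc hN2 (by linarith) hPsq hd1 ?_
        have := Nat.lt_div_mul_add (a := d - 1) hm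
        calc d ≤ (d - 1) / m * m + m := by omega
          _ = ((d - 1) / m + 1) * m := by ring
          _ ≤ _ := by gcongr; omega
    have h := card_le_two_pow_detNOF_lift (Nat.succ_ne_zero m) (traceProd F d (m + 1))
      (norm_sum_traceProd_le hs1 (hF ▸ hbig))
    rw [hF] at h
    have h' : Real.logb 2 N ≤ (detNOF (Lift (traceProd F d (m + 1))) : ℝ) := by
      rw [Real.logb_le_iff_le_rpow (by norm_num) (by positivity), Real.rpow_natCast]
      exact_mod_cast h
    exact h'
  · have hlogk : Real.logb 2 k ≤ a * Real.logb 2 N := by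
      have h := Real.logb_le_logb_of_le (b := 2) (by norm_num) (by positivity) hka
      rwa [Real.logb_rpow_eq_mul_logb_of_pos (by positivity)] at h
    rw [one_div, inv_mul_le_iff₀ hK]
    linarith
  · have hlogk := logb_two_le_self k
    rw [one_div, inv_mul_le_iff₀ hK]
    linarith
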